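/- Let $R$ be a unital, not necessarily commutative ring; modules are left $R$-modules. Let $L_R$ be the first-order language with symbols $0,+,-$ and, for each $r\in R$, a unary function symbol for left multiplication by $r$. Put $\tau=|R|+\aleph_0$, and let $T_{\infty,R}$ be the common $L_R$-theory of the free modules $R^{(\kappa)}$, $\kappa$ an infinite cardinal, i.e. the set of all $L_R$-sentences true in every such $R^{(\kappa)}$. A theory is $\kappa$-categorical if any two of its models of cardinality $\kappa$ are isomorphic. Consider the properties: (I) For every infinite set $I$, the direct product $R^I$ is a free $R$-module. (II) $T_{\infty,R}$ is $\tau^+$-categorical. (III) Every model of $T_{\infty,R}$ is a free $R$-module. (IV) The class of free $R$-modules is elementary, i.e. it is the class of all models of some set of $L_R$-sentences. Then (IV) implies (III), (III) implies (II), and (II) implies (I). Moreover, (III) implies that $T_{\infty,R}$ is $\kappa$-categorical for every $\kappa\ge\tau^+$. -/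

import Mathlib

open FirstOrder Cardinal

universe u

namespace FreeModuleTheory

/-- Function symbols of the language of left `R`-modules: `0`, `+`, `-` and, for every `r : R`,
a unary symbol for left multiplication by `r`. -/
inductive ModuleFunc (R : Type u) : ℕ → Type u
  | zero : ModuleFunc R 0
  | add : ModuleFunc R 2
  | neg : ModuleFunc R 1
  | smul (r : R) : ModuleFunc R 1

/-- The first-order language of left `R`-modules. -/
def moduleLang (R : Type u) : FirstOrder.Language.{u, 0} where
  Functions := ModuleFunc R
  Relations := fun _ => Empty

/-- A left `R`-module as a structure for the language of left `R`-modules. -/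
@[reducible] def moduleStructure (R : Type u) [Ring R] (M : Type u) [AddCommGroup M] [Module R M] :
    (moduleLang R).Structure M where
  funMap := fun {_} f =>
    match f with
    | ModuleFunc.zero => fun _ => 0
    | ModuleFunc.add => fun x => x 0 + x 1
    | ModuleFunc.neg => fun x => - x 0
    | ModuleFunc.smul r => fun x => r • x 0
  RelMap := fun r => r.elim

/-- The structure `M` is (the structure of) a free left `R`-module. -/
def IsFreeModule (R : Type u) [Ring R] (M : Type u) [S : (moduleLang R).Structure M] : Prop :=
  ∃ (_ : AddCommGroup M) (_ : Module R M), S = moduleStructure R M ∧ Module.Free R M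

/-- The sentence `φ` is true in the left `R`-module `M`. -/
def TrueIn (R : Type u) [Ring R] (M : Type u) [AddCommGroup M] [Module R M]
    (φ : (moduleLang R).Sentence) : Prop :=
  letI := moduleStructure R M
  M ⊨ φ

/-- The common theory of the free left `R`-modules on infinitely many generators: the set of all
sentences true in every `R^(X)`, `X` infinite. -/
def freeTheory (R : Type u) [Ring R] : (moduleLang R).Theory :=
  {φ | ∀ X : Type u, Infinite X → TrueIn R (X →₀ R) φ}

/-- The cardinality of `R` plus `ℵ₀`. -/
noncomputable def tau (R : Type u) : Cardinal.{u} := #R + ℵ₀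

/-- Every infinite power of the left module `R` is free. -/
def PowersFree (R : Type u) [Ring R] : Prop :=
  ∀ I : Type u, Infinite I → Module.Free R (I → R)

/-- All models of the common theory of the free modules on infinitely many generators are free. -/
def AllModelsFree (R : Type u) [Ring R] : Prop :=
  ∀ (M : Type u) [(moduleLang R).Structure M], M ⊨ freeTheory R → IsFreeModule R M

/-- The class of free left `R`-modules is elementary: it is the class of all models of some
first-order theory in the language of left `R`-modules. -/
def FreeElementary (R : Type u) [Ring R] : Prop :=
  ∃ A : (moduleLang R).Theory, ∀ (M : Type u) [(moduleLang R).Structure M],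
    M ⊨ A ↔ IsFreeModule R M

end FreeModuleTheory

/-! The substantial implication is from `τ⁺`-categoricity to freeness of powers. The other two are
soft: an elementary axiomatization is contained in the common theory, and a free module of size
above `τ` has a basis of its own size.

By elimination down to positive primitive (pp) formulas in the style of Baur and Monk
(`exists_pp_elimination`), any two `PPGeneric` modules are elementarily equivalent. Hence `F × (X →₀
R)` is a model whenever `X` is infinite and `F` is `RLike`. The `RLike` modules are closed under
products, direct sums, pure submodules and pure quotients, so they include `R^I / R^(I)` and its
small pure submodules.

For nonzero `R`, categoricity makes every `RLike` module `F` of size at most `τ` a direct summand of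
a free module (`exists_retract_free`) and, if `F` is nonzero, makes its trace ideal all of `R`
(`exists_sum_eq_one`). The first fact, used inside `R^ℕ / R^(ℕ)`, gives the descending chain
condition on principal right ideals, hence a minimal idempotent `e` with local corner ring. The
second then makes `P = R e` a summand of every small nonzero `RLike` module, and Zorn's lemma
decomposes every `RLike` module into copies of `P` (`IsUniversalSummand.exists_linearEquiv`).
Finally `R` is a finite sum of copies of `P`, and `R^I` splits as `R^(I)` plus a sum of copies of
`P`; being an infinite sum of copies of `P`, it is free. -/

namespace FreeModuleTheory

/-! ### Positive primitive formulas and the subgroups they define. -/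

section PositivePrimitive

variable {R : Type*} [Ring R] {n : ℕ}

/-- A positive primitive formula in `n` free variables: a finite system of linear equations, each
equating a linear form in the free variables with a linear form in existentially quantified
variables indexed by `ℕ`. -/
def PP (R : Type*) [Ring R] (n : ℕ) := List ((Fin n → R) × (ℕ →₀ R))

/-- The tuple `x` satisfies the positive primitive formula `φ`. -/
def Holds (φ : PP R n) {M : Type*} [AddCommGroup M] [Module R M] (x : Fin n → M) : Prop :=
  ∃ y : ℕ → M, ∀ p : (Fin n → R) × (ℕ →₀ R), List.Mem p φ →
    ∑ i, p.1 i • x i = Finsupp.linearCombination R y p.2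

variable {M N : Type*} [AddCommGroup M] [Module R M] [AddCommGroup N] [Module R N]

theorem map_linearCombination {α : Type*} (f : M →ₗ[R] N) (y : α → M) (l : α →₀ R) :
    Finsupp.linearCombination R (fun k => f (y k)) l = f (Finsupp.linearCombination R y l) := by
  simp [Finsupp.linearCombination_apply, Finsupp.sum, map_sum]

theorem Holds.map {φ : PP R n} {x : Fin n → M} (h : Holds φ x) (f : M →ₗ[R] N) :
    Holds φ (fun i => f (x i)) := by
  obtain ⟨y, hy⟩ := h
  refine ⟨fun k => f (y k), fun p hp => ?_⟩
  rw [map_linearCombination, ← hy p hp]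
  simp

theorem holds_zero (φ : PP R n) : Holds φ (fun _ => (0 : M)) :=
  ⟨fun _ => 0, fun p _ => by simp [Finsupp.linearCombination_apply]⟩

theorem linearCombination_add' {α : Type*} (y z : α → M) (l : α →₀ R) :
    Finsupp.linearCombination R (fun k => y k + z k) l =
      Finsupp.linearCombination R y l + Finsupp.linearCombination R z l := by
  simp [Finsupp.linearCombination_apply, Finsupp.sum, Finset.sum_add_distrib]

theorem linearCombination_neg' {α : Type*} (y : α → M) (l : α →₀ R) :
    Finsupp.linearCombination R (fun k => - y k) l = - Finsupp.linearCombination R y l := by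
  simp [Finsupp.linearCombination_apply, Finsupp.sum]

theorem Holds.add {φ : PP R n} {x x' : Fin n → M} (h : Holds φ x) (h' : Holds φ x') :
    Holds φ (fun i => x i + x' i) := by
  obtain ⟨y, hy⟩ := h
  obtain ⟨y', hy'⟩ := h'
  refine ⟨fun k => y k + y' k, fun p hp => ?_⟩
  rw [linearCombination_add', ← hy p hp, ← hy' p hp]
  simp [Finset.sum_add_distrib]

theorem Holds.neg {φ : PP R n} {x : Fin n → M} (h : Holds φ x) : Holds φ (fun i => - x i) := by
  obtain ⟨y, hy⟩ := h
  refine ⟨fun k => - y k, fun p hp => ?_⟩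
  rw [linearCombination_neg', ← hy p hp]
  simp

theorem Holds.sub {φ : PP R n} {x x' : Fin n → M} (h : Holds φ x) (h' : Holds φ x') :
    Holds φ (fun i => x i - x' i) := by
  simpa [sub_eq_add_neg] using h.add h'.neg

/-- The subgroup defined by a positive primitive formula in one free variable. -/
def PP.subgroup (φ : PP R 1) (M : Type*) [AddCommGroup M] [Module R M] : AddSubgroup M where
  carrier := {m | Holds φ (fun _ => m)}
  add_mem' h h' := h.add h'
  zero_mem' := holds_zero φ
  neg_mem' h := h.neg

theorem mem_subgroup {φ : PP R 1} {m : M} : m ∈ φ.subgroup M ↔ Holds φ (fun _ => m) := Iff.rfl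

theorem holds_pi {ι : Type*} {A : ι → Type*} [∀ j, AddCommGroup (A j)] [∀ j, Module R (A j)]
    {φ : PP R n} {x : Fin n → ∀ j, A j} (h : ∀ j, Holds φ (fun i => x i j)) : Holds φ x := by
  choose y hy using h
  refine ⟨fun k j => y j k, fun p hp => funext fun j => ?_⟩
  have := map_linearCombination (LinearMap.proj j : (∀ j, A j) →ₗ[R] A j) (fun k j => y j k) p.2
  simp only [LinearMap.proj_apply] at this
  rw [← this, ← hy j p hp]
  simp

/-- The formula that is always true. -/
def PP.top : PP R n := List.nil

theorem holds_top (x : Fin n → M) : Holds (PP.top : PP R n) x :=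
  ⟨fun _ => 0, fun _ hp => nomatch hp⟩

/-- Conjunction of positive primitive formulas. -/
noncomputable def PP.conj (φ ψ : PP R n) : PP R n :=
  List.append (List.map (fun p => (p.1, p.2.mapDomain fun k => 2 * k)) φ)
    (List.map (fun p => (p.1, p.2.mapDomain fun k => 2 * k + 1)) ψ)

theorem holds_conj {φ ψ : PP R n} {x : Fin n → M} :
    Holds (φ.conj ψ) x ↔ Holds φ x ∧ Holds ψ x := by
  constructor
  · rintro ⟨y, hy⟩
    refine ⟨⟨fun k => y (2 * k), fun p hp => ?_⟩, ⟨fun k => y (2 * k + 1), fun p hp => ?_⟩⟩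
    · have := hy _ (List.mem_append_left _ (List.mem_map_of_mem hp))
      simpa [Finsupp.linearCombination_mapDomain, Function.comp_def] using this
    · have := hy _ (List.mem_append_right _ (List.mem_map_of_mem hp))
      simpa [Finsupp.linearCombination_mapDomain, Function.comp_def] using this
  · rintro ⟨⟨y, hy⟩, ⟨z, hz⟩⟩
    -- Even indices carry the witnesses of `φ`, odd ones those of `ψ`, so the two systems do not
    -- interfere.
    refine ⟨fun k => if k % 2 = 0 then y (k / 2) else z (k / 2), fun p hp => ?_⟩
    rcases List.mem_append.1 hp with hp | hp
    · obtain ⟨q, hq, rfl⟩ := List.mem_map.1 hp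
      simpa [Finsupp.linearCombination_mapDomain, Function.comp_def] using hy q hq
    · obtain ⟨q, hq, rfl⟩ := List.mem_map.1 hp
      have h2 : ∀ k, (2 * k + 1) / 2 = k := fun k => by omega
      simpa [Finsupp.linearCombination_mapDomain, Function.comp_def, Nat.add_mod, h2] using hz q hq

/-- Conjunction of a finite list of positive primitive formulas. -/
noncomputable def PP.conjList (l : List (PP R n)) : PP R n := l.foldr PP.conj PP.top

theorem holds_conjList {l : List (PP R n)} {x : Fin n → M} :
    Holds (PP.conjList l) x ↔ ∀ φ ∈ l, Holds φ x := by
  induction l with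
  | nil => simp [PP.conjList, holds_top]
  | cons a l ih =>
    have : PP.conjList (a :: l) = a.conj (PP.conjList l) := rfl
    rw [this, holds_conj, ih]
    simp

/-- Existential quantification over the last free variable. -/
noncomputable def PP.ex (φ : PP R (n + 1)) : PP R n :=
  List.map (fun p => (fun i => p.1 i.castSucc,
    p.2.mapDomain Nat.succ - Finsupp.single 0 (p.1 (Fin.last n)))) φ

/-- The quantified variable becomes witness number 0, with its term moved across the equation; the
old witnesses shift by one. -/
theorem holds_ex {φ : PP R (n + 1)} {x : Fin n → M} :
    Holds φ.ex x ↔ ∃ m : M, Holds φ (Fin.snoc x m : Fin (n + 1) → M) := by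
  constructor
  · rintro ⟨y, hy⟩
    refine ⟨y 0, fun k => y (k + 1), fun p hp => ?_⟩
    have := hy _ (List.mem_map_of_mem hp)
    simpa [Fin.sum_univ_castSucc, Finsupp.linearCombination_mapDomain, Function.comp_def,
      eq_sub_iff_add_eq] using this
  · rintro ⟨m, y, hy⟩
    refine ⟨fun k => Nat.casesOn k m y, fun p hp => ?_⟩
    obtain ⟨q, hq, rfl⟩ := List.mem_map.1 hp
    have := hy q hq
    simpa [Fin.sum_univ_castSucc, Finsupp.linearCombination_mapDomain, Function.comp_def,
      eq_sub_iff_add_eq] using this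

/-- Substitution of `0` for all free variables but the last. -/
def PP.atZero (φ : PP R (n + 1)) : PP R 1 :=
  List.map (fun p => (fun _ => p.1 (Fin.last n), p.2)) φ

theorem holds_atZero {φ : PP R (n + 1)} {m : M} :
    Holds φ.atZero (fun _ => m) ↔
      Holds φ (Fin.snoc (fun _ => (0 : M)) m : Fin (n + 1) → M) := by
  refine exists_congr fun y => ⟨fun h p hp => ?_, fun h p hp => ?_⟩
  · simpa [Fin.sum_univ_castSucc] using h _ (List.mem_map_of_mem hp)
  · obtain ⟨q, hq, rfl⟩ := List.mem_map.1 hp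
    simpa [Fin.sum_univ_castSucc] using h q hq

/-- The module `M` satisfies all implications between positive primitive formulas in one free
variable that hold in `R`. -/
def RLike (R : Type*) [Ring R] (M : Type*) [AddCommGroup M] [Module R M] : Prop :=
  ∀ φ ψ : PP R 1, φ.subgroup R ≤ ψ.subgroup R → φ.subgroup M ≤ ψ.subgroup M

theorem RLike.self : RLike R R := fun _ _ h => h

theorem RLike.pi {ι : Type*} {A : ι → Type*} [∀ j, AddCommGroup (A j)] [∀ j, Module R (A j)]
    (h : ∀ j, RLike R (A j)) : RLike R (∀ j, A j) := fun φ ψ hφ _ hm =>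
  holds_pi fun j => h j φ ψ hφ (Holds.map hm (LinearMap.proj j : (∀ j, A j) →ₗ[R] A j))

theorem RLike.finsupp {F : Type*} [AddCommGroup F] [Module R F] (h : RLike R F) (ι : Type*) :
    RLike R (ι →₀ F) := fun φ ψ hφ m hm => by
  rw [← Finsupp.sum_single m]
  exact sum_mem fun c _ => Holds.map (h φ ψ hφ (Holds.map hm (Finsupp.lapply (R := R) c)))
    (Finsupp.lsingle (R := R) c)

theorem RLike.prod (hM : RLike R M) (hN : RLike R N) : RLike R (M × N) := fun φ ψ hφ m hm => by
  have h1 := Holds.map (hM φ ψ hφ (Holds.map hm (LinearMap.fst R M N))) (LinearMap.inl R M N)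
  have h2 := Holds.map (hN φ ψ hφ (Holds.map hm (LinearMap.snd R M N))) (LinearMap.inr R M N)
  simpa [mem_subgroup] using h1.add h2

end PositivePrimitive

/-! ### The back-and-forth step for pp-generic modules. -/

section Elimination

open scoped Pointwise

variable {R : Type*} [Ring R] {n : ℕ}

/-- Every pair of positive primitive formulas in one free variable has in `M` index one or infinite
index, according to whether the corresponding implication holds in `R` or not. -/
structure PPGeneric (R : Type*) [Ring R] (M : Type*) [AddCommGroup M] [Module R M] : Prop where
  rlike : RLike R M
  infinite_index : ∀ φ ψ : PP R 1, ¬ φ.subgroup R ≤ ψ.subgroup R →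
    ¬ ((ψ.subgroup M).addSubgroupOf (φ.subgroup M)).FiniteIndex

variable {M N : Type*} [AddCommGroup M] [Module R M] [AddCommGroup N] [Module R N]

/-- With the other coordinates fixed, a nonempty solution set is a coset of the subgroup of the
homogeneous formula. -/
theorem holds_snoc_iff {φ : PP R (n + 1)} {x : Fin n → M} {m m' : M}
    (h : Holds φ (Fin.snoc x m : Fin (n + 1) → M)) :
    Holds φ (Fin.snoc x m' : Fin (n + 1) → M) ↔ m' - m ∈ φ.atZero.subgroup M := by
  rw [mem_subgroup, holds_atZero]
  constructor
  · intro h'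
    have := h'.sub h
    convert this using 1
    funext i
    refine Fin.lastCases ?_ (fun j => ?_) i <;> simp
  · intro h'
    have := h'.add h
    convert this using 1
    funext i
    refine Fin.lastCases ?_ (fun j => ?_) i <;> simp

/-- Let `Φ` be the conjunction of the formulas of `D` true of `(a, c)`. If every solution `d` of `Φ`
over `b` satisfied a further formula of `D`, finitely many cosets would cover the coset of
solutions. One such `δ` would then contain `Φ` homogeneously; transferring a common solution of `δ`
and `Φ` back to `a` would force `δ` on `c` itself. -/
theorem exists_extension (hM : PPGeneric R M) (hN : PPGeneric R N) (D : Finset (PP R (n + 1)))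
    (a : Fin n → M) (b : Fin n → N)
    (hab : ∀ S ⊆ D, Holds (PP.conjList S.toList).ex a ↔ Holds (PP.conjList S.toList).ex b)
    (c : M) : ∃ d : N, ∀ δ ∈ D, Holds δ (Fin.snoc a c : Fin (n + 1) → M) ↔
      Holds δ (Fin.snoc b d : Fin (n + 1) → N) := by
  classical
  set S := D.filter fun δ => Holds δ (Fin.snoc a c : Fin (n + 1) → M) with hS
  set Φ := PP.conjList S.toList with hΦ
  have hΦc : Holds Φ (Fin.snoc a c : Fin (n + 1) → M) := by
    rw [hΦ, holds_conjList]
    intro φ hφ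
    exact (Finset.mem_filter.1 (Finset.mem_toList.1 hφ)).2
  obtain ⟨d₀, hd₀⟩ := holds_ex.1 ((hab S (Finset.filter_subset _ _)).1 (holds_ex.2 ⟨c, hΦc⟩))
  by_contra! hcon
  set G := Φ.atZero.subgroup N with hG
  have hΦG : ∀ g : G, Holds Φ (Fin.snoc b (d₀ + g) : Fin (n + 1) → N) := fun g => by
    rw [holds_snoc_iff hd₀]
    simp
  have hex : ∀ g : G, ∃ δ ∈ D \ S, Holds δ (Fin.snoc b (d₀ + g) : Fin (n + 1) → N) := by
    intro g
    obtain ⟨δ, hδ, h⟩ := hcon (d₀ + g)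
    have h1 := holds_conjList.1 (hΦG g)
    by_cases hδS : δ ∈ S
    · have h2 := h1 δ (Finset.mem_toList.2 hδS)
      have h3 := (Finset.mem_filter.1 hδS).2
      tauto
    · refine ⟨δ, Finset.mem_sdiff.2 ⟨hδ, hδS⟩, ?_⟩
      have h3 : ¬ Holds δ (Fin.snoc a c : Fin (n + 1) → M) := fun h3 =>
        hδS (Finset.mem_filter.2 ⟨hδ, h3⟩)
      tauto
  set T := (D \ S).filter fun δ => ∃ g : G, Holds δ (Fin.snoc b (d₀ + g) : Fin (n + 1) → N) with hT
  let w : PP R (n + 1) → G := fun δ =>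
    if h : ∃ g : G, Holds δ (Fin.snoc b (d₀ + g) : Fin (n + 1) → N) then h.choose else 0
  have hw : ∀ δ ∈ T, Holds δ (Fin.snoc b (d₀ + w δ) : Fin (n + 1) → N) := fun δ hδ => by
    have h := (Finset.mem_filter.1 hδ).2
    simp only [w, dif_pos h]
    exact h.choose_spec
  have hcover : ⋃ δ ∈ T, w δ +ᵥ (((δ.atZero.subgroup N).addSubgroupOf G : AddSubgroup G) : Set G) =
      Set.univ := by
    refine Set.eq_univ_of_forall fun g => ?_
    obtain ⟨δ, hδ, h⟩ := hex g
    have hδT : δ ∈ T := Finset.mem_filter.2 ⟨hδ, g, h⟩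
    refine Set.mem_iUnion₂.2 ⟨δ, hδT, ?_⟩
    rw [holds_snoc_iff (hw δ hδT)] at h
    rw [mem_leftAddCoset_iff, SetLike.mem_coe, AddSubgroup.mem_addSubgroupOf]
    convert h using 1
    push_cast
    abel
  -- B. H. Neumann's lemma: among finitely many cosets covering a group, one belongs to a subgroup
  -- of finite index.
  obtain ⟨δ, hδT, hfin⟩ := AddSubgroup.exists_finiteIndex_of_leftCoset_cover hcover
  have hle : Φ.atZero.subgroup R ≤ δ.atZero.subgroup R := by
    by_contra h
    exact hN.infinite_index _ _ h hfin
  have hδ := Finset.mem_sdiff.1 (Finset.mem_filter.1 hδT).1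
  have hins : insert δ S ⊆ D :=
    Finset.insert_subset hδ.1 (Finset.filter_subset _ _)
  have hb : Holds (PP.conjList (insert δ S).toList).ex b := by
    refine holds_ex.2 ⟨d₀ + w δ, holds_conjList.2 fun φ hφ => ?_⟩
    rcases Finset.mem_insert.1 (Finset.mem_toList.1 hφ) with rfl | hφ
    · exact hw _ hδT
    · exact holds_conjList.1 (hΦG (w δ)) φ (Finset.mem_toList.2 hφ)
  obtain ⟨c', hc'⟩ := holds_ex.1 ((hab _ hins).2 hb)
  rw [holds_conjList] at hc'
  have hδc' := hc' δ (Finset.mem_toList.2 (Finset.mem_insert_self _ _))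
  have hΦc' : Holds Φ (Fin.snoc a c' : Fin (n + 1) → M) := holds_conjList.2 fun φ hφ =>
    hc' φ (Finset.mem_toList.2 (Finset.mem_insert_of_mem (Finset.mem_toList.1 hφ)))
  have h1 := hM.rlike _ _ hle ((holds_snoc_iff hΦc').1 hΦc)
  exact hδ.2 (Finset.mem_filter.2 ⟨hδ.1, (holds_snoc_iff hδc').2 h1⟩)

end Elimination

/-! ### Elimination to pp formulas, and pp-generic modules. -/

section Formulas

variable {R : Type u} [Ring R]

attribute [local instance] moduleStructure

theorem exists_coeff_realize {n : ℕ} (t : (moduleLang R).Term (Empty ⊕ Fin n)) :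
    ∃ a : Fin n → R, ∀ (M : Type u) [AddCommGroup M] [Module R M] (x : Fin n → M),
      t.realize (Sum.elim default x) = ∑ i, a i • x i := by
  classical
  induction t with
  | var v =>
    rcases v with v | i
    · exact v.elim
    · exact ⟨Pi.single i 1, fun M _ _ x => by simp [Pi.single_apply, ite_smul]⟩
  | func f ts ih =>
    choose a ha using ih
    cases f with
    | zero => exact ⟨0, fun M _ _ x => by simp [Language.Term.realize, Language.Structure.funMap]⟩
    | add => exact ⟨fun i => a 0 i + a 1 i, fun M _ _ x => by
        simp [Language.Term.realize, Language.Structure.funMap, ha, add_smul,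
          Finset.sum_add_distrib]⟩
    | neg => exact ⟨fun i => - a 0 i, fun M _ _ x => by
        simp [Language.Term.realize, Language.Structure.funMap, ha]⟩
    | smul r => exact ⟨fun i => r * a 0 i, fun M _ _ x => by
        simp [Language.Term.realize, Language.Structure.funMap, ha, mul_smul, Finset.smul_sum]⟩

theorem exists_pp_elimination {n : ℕ} (θ : (moduleLang R).BoundedFormula Empty n) :
    ∃ D : Finset (PP R n), ∀ (M N : Type u) [AddCommGroup M] [Module R M] [AddCommGroup N]
      [Module R N], PPGeneric R M → PPGeneric R N → ∀ (a : Fin n → M) (b : Fin n → N),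
      (∀ δ ∈ D, Holds δ a ↔ Holds δ b) → (θ.Realize default a ↔ θ.Realize default b) := by
  classical
  induction θ with
  | falsum => exact ⟨∅, fun M N _ _ _ _ _ _ a b _ => Iff.rfl⟩
  | equal t₁ t₂ =>
    obtain ⟨a₁, h₁⟩ := exists_coeff_realize t₁
    obtain ⟨a₂, h₂⟩ := exists_coeff_realize t₂
    have key : ∀ (M : Type u) [AddCommGroup M] [Module R M] (x : Fin _ → M),
        (Language.BoundedFormula.equal t₁ t₂).Realize default x ↔
          Holds (List.cons (fun i => a₁ i - a₂ i, 0) List.nil : PP R _) x := by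
      intro M _ _ x
      rw [Language.BoundedFormula.Realize, h₁, h₂]
      constructor
      · intro h
        refine ⟨fun _ => 0, fun p hp => ?_⟩
        obtain rfl := List.mem_singleton.1 hp
        simp [sub_smul, h]
      · rintro ⟨y, hy⟩
        have := hy _ (List.mem_singleton_self _)
        simpa [sub_smul, sub_eq_zero] using this
    refine ⟨{List.cons (fun i => a₁ i - a₂ i, 0) List.nil}, fun M N _ _ _ _ _ _ a b h => ?_⟩
    rw [key, key]
    exact h _ (Finset.mem_singleton_self _)
  | rel r => exact r.elim
  | imp f g ihf ihg =>
    obtain ⟨D, hD⟩ := ihf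
    obtain ⟨E, hE⟩ := ihg
    refine ⟨D ∪ E, fun M N _ _ _ _ hM hN a b h => ?_⟩
    have h1 := hD M N hM hN a b fun δ hδ => h δ (Finset.mem_union_left _ hδ)
    have h2 := hE M N hM hN a b fun δ hδ => h δ (Finset.mem_union_right _ hδ)
    rw [Language.BoundedFormula.realize_imp, Language.BoundedFormula.realize_imp, h1, h2]
  | all f ih =>
    obtain ⟨D, hD⟩ := ih
    -- All conjunctions over subsets of `D` are needed, since which formulas hold at the new element
    -- is not known in advance.
    refine ⟨D.powerset.image fun S => (PP.conjList S.toList).ex,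
      fun M N _ _ _ _ hM hN a b h => ?_⟩
    have hab : ∀ S ⊆ D, Holds (PP.conjList S.toList).ex a ↔ Holds (PP.conjList S.toList).ex b :=
      fun S hS => h _ (Finset.mem_image_of_mem _ (Finset.mem_powerset.2 hS))
    rw [Language.BoundedFormula.realize_all, Language.BoundedFormula.realize_all]
    constructor
    · intro hall d
      obtain ⟨c, hc⟩ := exists_extension hN hM D b a (fun S hS => (hab S hS).symm) d
      exact (hD N M hN hM _ _ hc).2 (hall c)
    · intro hall c
      obtain ⟨d, hd⟩ := exists_extension hM hN D a b hab c
      exact (hD M N hM hN _ _ hd).2 (hall d)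

theorem trueIn_iff_of_ppGeneric {M N : Type u} [AddCommGroup M] [Module R M] [AddCommGroup N]
    [Module R N] (hM : PPGeneric R M) (hN : PPGeneric R N) (θ : (moduleLang R).Sentence) :
    TrueIn R M θ ↔ TrueIn R N θ := by
  obtain ⟨D, hD⟩ := exists_pp_elimination θ
  refine hD M N hM hN default default fun δ _ => ?_
  have h1 : Holds δ (default : Fin 0 → M) := by
    convert holds_zero (M := M) δ
  have h2 : Holds δ (default : Fin 0 → N) := by
    convert holds_zero (M := N) δ
  exact ⟨fun _ => h2, fun _ => h1⟩

/-- Copies of one `r` in `φ(R)` outside `ψ(R)`, placed in infinitely many independent coordinates,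
lie in distinct cosets: projecting a difference of two copies recovers `r`. -/
theorem RLike.ppGeneric {M X : Type*} [AddCommGroup M] [Module R M] (hM : RLike R M) [Infinite X]
    (ι : X → R →ₗ[R] M) (π : X → M →ₗ[R] R) (h₁ : ∀ x r, π x (ι x r) = r)
    (h₂ : ∀ x y r, x ≠ y → π y (ι x r) = 0) : PPGeneric R M where
  rlike := hM
  infinite_index φ ψ hφ hfin := by
    obtain ⟨r, hr, hr'⟩ := Set.not_subset.1 hφ
    let f : X → φ.subgroup M := fun x => ⟨ι x r, Holds.map hr (ι x)⟩
    obtain ⟨x, y, hxy, h⟩ := Finite.exists_ne_map_eq_of_infinite fun x =>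
      (QuotientAddGroup.mk (f x) : _ ⧸ (ψ.subgroup _).addSubgroupOf (φ.subgroup M))
    rw [QuotientAddGroup.eq, AddSubgroup.mem_addSubgroupOf] at h
    have := Holds.map h (π y)
    apply hr'
    change Holds ψ fun _ => r
    simpa [f, h₁, h₂ x y r hxy] using this

theorem ppGeneric_finsupp (X : Type*) [Infinite X] : PPGeneric R (X →₀ R) :=
  (RLike.self.finsupp X).ppGeneric (X := X) (Finsupp.lsingle (R := R)) (Finsupp.lapply (R := R))
    (fun x r => by simp) (fun x y r h => by simp [h])

theorem ppGeneric_prod_finsupp {F : Type*} [AddCommGroup F] [Module R F] (hF : RLike R F)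
    (X : Type*) [Infinite X] : PPGeneric R (F × (X →₀ R)) :=
  (hF.prod (RLike.self.finsupp X)).ppGeneric (X := X)
    (fun x => LinearMap.inr R F (X →₀ R) ∘ₗ Finsupp.lsingle (R := R) x)
    (fun x => Finsupp.lapply (R := R) x ∘ₗ LinearMap.snd R F (X →₀ R))
    (fun x r => by simp) (fun x y r h => by simp [h])

end Formulas

/-! ### Pure monomorphisms. -/

section Purity

variable {R : Type*} [Ring R] {A B M P : Type*} [AddCommGroup A] [Module R A] [AddCommGroup B]
  [Module R B] [AddCommGroup M] [Module R M] [AddCommGroup P] [Module R P]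

/-- A linear map is a pure monomorphism if every finite system of linear equations with constants
in the domain that is solvable in the codomain is solvable in the domain. -/
def PureMono (f : A →ₗ[R] M) : Prop :=
  ∀ S : List ((ℕ →₀ R) × A),
    (∃ y : ℕ → M, ∀ p ∈ S, Finsupp.linearCombination R y p.1 = f p.2) →
    ∃ y : ℕ → A, ∀ p ∈ S, Finsupp.linearCombination R y p.1 = p.2

theorem linearCombination_sub' {α : Type*} (y z : α → M) (l : α →₀ R) :
    Finsupp.linearCombination R (fun k => y k - z k) l =
      Finsupp.linearCombination R y l - Finsupp.linearCombination R z l := by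
  simp [Finsupp.linearCombination_apply, Finsupp.sum, smul_sub]

theorem PureMono.injective {f : A →ₗ[R] M} (hf : PureMono f) : Function.Injective f := by
  rw [injective_iff_map_eq_zero]
  intro a ha
  obtain ⟨y, hy⟩ := hf [(0, a)] ⟨0, by simp [ha]⟩
  simpa using (hy (0, a) (by simp)).symm

theorem PureMono.of_leftInverse {f : A →ₗ[R] M} (g : M →ₗ[R] A) (h : ∀ a, g (f a) = a) :
    PureMono f := by
  rintro S ⟨y, hy⟩
  refine ⟨fun k => g (y k), fun p hp => ?_⟩
  rw [map_linearCombination, hy p hp, h]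

theorem PureMono.comp {f : A →ₗ[R] B} {g : B →ₗ[R] M} (hg : PureMono g) (hf : PureMono f) :
    PureMono (g ∘ₗ f) := by
  rintro S ⟨y, hy⟩
  obtain ⟨z, hz⟩ := hg (S.map fun p => (p.1, f p.2)) ⟨y, List.forall_mem_map.2 hy⟩
  exact hf S ⟨z, List.forall_mem_map.1 hz⟩

theorem PureMono.of_comp_surjective {f : A →ₗ[R] M} {σ : B →ₗ[R] A}
    (hσ : Function.Surjective σ) (h : PureMono (f ∘ₗ σ)) : PureMono f := by
  rintro S ⟨y, hy⟩
  obtain ⟨z, hz⟩ := h (S.map fun p => (p.1, Function.surjInv hσ p.2))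
    ⟨y, List.forall_mem_map.2 fun p hp => by
      rw [hy p hp, LinearMap.comp_apply, Function.surjInv_eq hσ]⟩
  refine ⟨fun k => σ (z k), fun p hp => ?_⟩
  rw [map_linearCombination, hz (p.1, Function.surjInv hσ p.2) (List.mem_map_of_mem hp),
    Function.surjInv_eq hσ]

theorem PureMono.rlike {f : A →ₗ[R] M} (hf : PureMono f) (hM : RLike R M) : RLike R A := by
  intro φ ψ hφ a ha
  obtain ⟨y, hy⟩ := hM φ ψ hφ (Holds.map ha f)
  obtain ⟨z, hz⟩ := hf (List.map (fun p : (Fin 1 → R) × (ℕ →₀ R) => (p.2, p.1 0 • a)) ψ) ⟨y, by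
    intro p hp
    obtain ⟨q, hq, rfl⟩ := List.mem_map.1 hp
    simpa using (hy q hq).symm⟩
  refine ⟨z, fun p hp => ?_⟩
  simpa using (hz _ (List.mem_map_of_mem hp)).symm

/-- A solution of `φ` in the quotient lifts to `M` with errors in the image of `A`. Purity absorbs
the errors into a correction from `A`, so the class has a representative satisfying `φ` in `M`
itself. -/
theorem PureMono.rlike_quotient {f : A →ₗ[R] M} (hf : PureMono f) (hM : RLike R M) :
    RLike R (M ⧸ LinearMap.range f) := by
  intro φ ψ hφ m hm
  obtain ⟨m, rfl⟩ := Submodule.mkQ_surjective _ m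
  obtain ⟨y, hy⟩ := hm
  choose y' hy' using fun k => Submodule.mkQ_surjective _ (y k)
  obtain rfl : (fun k => (LinearMap.range f).mkQ (y' k)) = y := funext hy'
  have h1 : ∀ p : (Fin 1 → R) × (ℕ →₀ R), ∃ a : A, List.Mem p φ →
      f a = p.1 0 • m - Finsupp.linearCombination R y' p.2 := by
    intro p
    by_cases hp : List.Mem p φ
    · have := hy p hp
      rw [map_linearCombination] at this
      have h2 : p.1 0 • m - Finsupp.linearCombination R y' p.2 ∈ LinearMap.range f := by
        rw [← Submodule.ker_mkQ (LinearMap.range f), LinearMap.mem_ker, map_sub, ← this]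
        simp
      obtain ⟨a, ha⟩ := h2
      exact ⟨a, fun _ => ha⟩
    · exact ⟨0, fun h => absurd h hp⟩
  choose a ha using h1
  obtain ⟨z, hz⟩ := hf (List.map (fun p : (Fin 1 → R) × (ℕ →₀ R) =>
      (Finsupp.single 0 (p.1 0) - p.2.mapDomain Nat.succ, a p)) φ)
    ⟨fun k => Nat.casesOn k m y', by
      intro p hp
      obtain ⟨q, hq, rfl⟩ := List.mem_map.1 hp
      simp [ha q hq, Finsupp.linearCombination_mapDomain, Function.comp_def]⟩
  have h3 : m - f (z 0) ∈ φ.subgroup M := by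
    refine ⟨fun k => y' k - f (z (k + 1)), fun p hp => ?_⟩
    have h4 := congrArg f (hz _ (List.mem_map_of_mem hp))
    rw [ha p hp] at h4
    rw [linearCombination_sub', map_linearCombination f (fun k => z (k + 1))]
    simp only [map_sub, Finsupp.linearCombination_single, Finsupp.linearCombination_mapDomain,
      Function.comp_def, map_smul] at h4
    simp only [Finset.univ_unique, Fin.default_eq_zero, Finset.sum_singleton, smul_sub]
    rw [sub_eq_sub_iff_add_eq_add] at h4 ⊢
    exact h4.symm.trans (add_comm _ _)
  have h5 := Holds.map (hM φ ψ hφ h3) (LinearMap.range f).mkQ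
  have h6 : (LinearMap.range f).mkQ (f (z 0)) = 0 := by simp
  change Holds ψ fun _ => (LinearMap.range f).mkQ m
  simpa only [map_sub, h6, sub_zero] using h5

/-- Solve first for the `P`-coordinate modulo the range of `f`; subtracting it leaves a system with
constants in `A`. -/
theorem PureMono.coprod {f : A →ₗ[R] M} (hf : PureMono f) {h : P →ₗ[R] M}
    (hh : PureMono ((LinearMap.range f).mkQ ∘ₗ h)) : PureMono (f.coprod h) := by
  rintro S ⟨y, hy⟩
  have h0 : ∀ a, (LinearMap.range f).mkQ (f a) = 0 := by simp
  obtain ⟨z, hz⟩ := hh (S.map fun p => (p.1, p.2.2)) ⟨fun k => (LinearMap.range f).mkQ (y k), by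
    intro p hp
    obtain ⟨q, hq, rfl⟩ := List.mem_map.1 hp
    rw [map_linearCombination, hy q hq, LinearMap.coprod_apply, map_add, h0, zero_add]
    rfl⟩
  obtain ⟨w, hw⟩ := hf (S.map fun p => (p.1, p.2.1)) ⟨fun k => y k - h (z k), by
    intro p hp
    obtain ⟨q, hq, rfl⟩ := List.mem_map.1 hp
    have := hz (q.1, q.2.2) (List.mem_map_of_mem hq)
    rw [linearCombination_sub', map_linearCombination, hy q hq, this]
    simp⟩
  refine ⟨fun k => (w k, z k), fun p hp => ?_⟩
  have h1 : Finsupp.linearCombination R w p.1 = p.2.1 := List.forall_mem_map.1 hw p hp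
  have h2 : Finsupp.linearCombination R z p.1 = p.2.2 := List.forall_mem_map.1 hz p hp
  refine Prod.ext ?_ ?_
  · rw [← h1]
    exact (map_linearCombination (LinearMap.fst R A P) (fun k => (w k, z k)) p.1).symm
  · rw [← h2]
    exact (map_linearCombination (LinearMap.snd R A P) (fun k => (w k, z k)) p.1).symm

theorem pureMono_finsupp_pi (I : Type*) :
    PureMono (Finsupp.lcoeFun : (I →₀ R) →ₗ[R] I → R) := by
  classical
  rintro S ⟨y, hy⟩
  -- The finitely many constants live on the finite set `s`; truncating a solution to `s` keeps it a
  -- solution.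
  let s : Finset I := S.toFinset.biUnion fun p => p.2.support
  refine ⟨fun k => Finsupp.onFinset s (fun i => if i ∈ s then y k i else 0) (by
    intro i; simp +contextual), fun p hp => ?_⟩
  ext i
  have h1 := map_linearCombination (Finsupp.lapply (R := R) (M := R) i)
    (fun k => Finsupp.onFinset s (fun i => if i ∈ s then y k i else 0) (by
      intro i; simp +contextual)) p.1
  rw [← Finsupp.lapply_apply (R := R), ← h1]
  by_cases hi : i ∈ s
  · have h2 := congrFun (hy p hp) i
    have h3 := map_linearCombination (LinearMap.proj i : (I → R) →ₗ[R] R) y p.1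
    simp only [LinearMap.proj_apply] at h3
    rw [← h3] at h2
    simpa [hi] using h2
  · have h4 : p.2 i = 0 := by
      by_contra h
      exact hi (Finset.mem_biUnion.2 ⟨p, List.mem_toFinset.2 hp, Finsupp.mem_support_iff.2 h⟩)
    simp [hi, h4, Finsupp.linearCombination_apply]

end Purity

/-! ### Small pure submodules by Skolem closure. -/

section SmallPure

variable {R : Type u} [Ring R] {M : Type u} [AddCommGroup M] [Module R M]

/-- The language with a function symbol for every coordinate of a solution of a finite system of
linear equations, as a function of the constants of the system. -/
def solutionLang (R : Type u) [Ring R] : FirstOrder.Language.{u, 0} where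
  Functions := fun k => (Fin k → ℕ →₀ R) × ℕ
  Relations := fun _ => Empty

open Classical in
/-- The structure given by a choice of solutions for the solvable systems. -/
@[reducible] noncomputable def solutionStructure (R : Type u) [Ring R] (M : Type u)
    [AddCommGroup M] [Module R M] : (solutionLang R).Structure M where
  funMap := fun {k} (f : (Fin k → ℕ →₀ R) × ℕ) c =>
    if h : ∃ y : ℕ → M, ∀ i, Finsupp.linearCombination R y (f.1 i) = c i then h.choose f.2 else 0
  RelMap := fun r => r.elim

theorem aleph0_le_tau (R : Type u) : ℵ₀ ≤ tau R := self_le_add_left _ _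

theorem mk_le_tau (R : Type u) : #R ≤ tau R := self_le_add_right _ _

theorem mk_solutionLang_functions_le : #(Σ k, (solutionLang R).Functions k) ≤ tau R := by
  have h : Function.Injective (fun f : Σ k, (solutionLang R).Functions k =>
      ((List.ofFn f.2.1, f.2.2) : List (ℕ →₀ R) × ℕ)) := by
    rintro ⟨k, f, i⟩ ⟨l, g, j⟩ hfg
    simp only [Prod.mk.injEq] at hfg
    obtain ⟨h1, rfl⟩ := hfg
    cases List.ofFn_inj'.1 h1
    rfl
  have h2 : #(ℕ →₀ R) ≤ tau R := by
    cases subsingleton_or_nontrivial R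
    · exact (le_one_iff_subsingleton.2 inferInstance).trans (one_le_aleph0.trans (aleph0_le_tau R))
    rw [mk_finsupp_lift_of_infinite]
    simp only [mk_nat, lift_aleph0, lift_uzero]
    exact max_le (aleph0_le_tau R) (mk_le_tau R)
  have h3 := aleph0_le_tau R
  refine (mk_le_of_injective h).trans ?_
  rw [mk_prod]
  simp only [mk_nat, lift_aleph0, lift_uzero]
  exact mul_le_of_le h3 ((mk_list_le_max _).trans (max_le h3 h2)) h3

theorem exists_small_pure (X : Set M) (hX : #X ≤ tau R) :
    ∃ L : Submodule R M, X ⊆ L ∧ PureMono L.subtype ∧ #L ≤ tau R := by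
  let := solutionStructure R M
  set K := Language.Substructure.closure (solutionLang R) (insert 0 X) with hK
  have h3 := aleph0_le_tau R
  have hsub : insert 0 X ⊆ (K : Set M) := Language.Substructure.subset_closure
  have hsolve : ∀ S : List ((ℕ →₀ R) × M), (∀ p ∈ S, p.2 ∈ K) →
      (∃ y : ℕ → M, ∀ p ∈ S, Finsupp.linearCombination R y p.1 = p.2) →
      ∃ y : ℕ → M, (∀ k, y k ∈ K) ∧ ∀ p ∈ S, Finsupp.linearCombination R y p.1 = p.2 := by
    rintro S hS ⟨y, hy⟩
    have h : ∃ y : ℕ → M, ∀ i : Fin S.length,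
        Finsupp.linearCombination R y (S.get i).1 = (S.get i).2 :=
      ⟨y, fun i => hy _ (List.get_mem _ _)⟩
    refine ⟨h.choose, fun k => ?_, fun p hp => ?_⟩
    · have := K.fun_mem (n := S.length)
        ((fun i => (S.get i).1, k) : (Fin S.length → ℕ →₀ R) × ℕ)
        (fun i => (S.get i).2) (fun i => hS _ (List.get_mem _ _))
      exact Eq.mp (congrArg (· ∈ K) (dif_pos h)) this
    · obtain ⟨i, rfl⟩ := List.get_of_mem hp
      exact h.choose_spec i
  have hzero : (0 : M) ∈ K := hsub (Set.mem_insert _ _)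
  let L : Submodule R M :=
    { carrier := K
      zero_mem' := hzero
      add_mem' := by
        intro a b ha hb
        -- The language has no symbol for addition; the sum is the unique value of `y 0` in the
        -- system `y 0 - y 1 = a`, `y 1 = b`. Scalar multiples are obtained likewise.
        obtain ⟨y, hyK, hy⟩ := hsolve [(Finsupp.single 0 1 - Finsupp.single 1 1, a),
          (Finsupp.single 1 1, b)] (by simpa using ⟨ha, hb⟩)
          ⟨fun k => if k = 0 then a + b else b, by simp⟩
        have h1 : y 0 - y 1 = a := by simpa using hy _ (List.mem_cons_self)
        have h2 : y 1 = b := by simpa using hy _ (List.mem_cons_of_mem _ List.mem_cons_self)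
        rw [← h1, h2, sub_add_cancel]
        exact hyK 0
      smul_mem' := by
        intro r a ha
        obtain ⟨y, hyK, hy⟩ := hsolve [(Finsupp.single 0 1 - Finsupp.single 1 r, 0),
          (Finsupp.single 1 1, a)] (by simpa using ⟨hzero, ha⟩)
          ⟨fun k => if k = 0 then r • a else a, by simp⟩
        have h1 : y 0 - r • y 1 = 0 := by simpa using hy _ (List.mem_cons_self)
        have h2 : y 1 = a := by simpa using hy _ (List.mem_cons_of_mem _ List.mem_cons_self)
        rw [← h2, ← sub_eq_zero.1 h1]
        exact hyK 0 }
  refine ⟨L, fun x hx => hsub (Set.mem_insert_of_mem _ hx), ?_, ?_⟩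
  · rintro S ⟨y, hy⟩
    obtain ⟨z, hzK, hz⟩ := hsolve (S.map fun p => (p.1, (p.2 : M))) (by
      intro p hp
      obtain ⟨q, hq, rfl⟩ := List.mem_map.1 hp
      exact q.2.2) ⟨y, by
        intro p hp
        obtain ⟨q, hq, rfl⟩ := List.mem_map.1 hp
        exact hy q hq⟩
    refine ⟨fun k => ⟨z k, hzK k⟩, fun p hp => Subtype.ext ?_⟩
    have h1 := map_linearCombination L.subtype (fun k => ⟨z k, hzK k⟩) p.1
    have h2 := hz _ (List.mem_map_of_mem hp)
    exact h1.symm.trans h2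
  · have := Language.Substructure.lift_card_closure_le (L := solutionLang R) (s := insert (0 : M) X)
    simp only [lift_id] at this
    refine (this : #L ≤ _).trans (max_le h3 ?_)
    refine add_le_of_le h3 (mk_insert_le.trans ?_) mk_solutionLang_functions_le
    exact add_le_of_le h3 hX (one_le_aleph0.trans h3)

end SmallPure

/-! ### Algebraic consequences of categoricity in `τ⁺`. -/

section Categoricity

variable {R : Type u} [Ring R]

theorem PPGeneric.models {M : Type u} [AddCommGroup M] [Module R M] (hM : PPGeneric R M) :
    letI := moduleStructure R M
    M ⊨ freeTheory R := by
  let := moduleStructure R M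
  refine ⟨fun φ hφ => ?_⟩
  exact (trueIn_iff_of_ppGeneric (ppGeneric_finsupp (ULift.{u} ℕ)) hM φ).1 (hφ _ inferInstance)

theorem nonempty_linearEquiv_of_equiv {M N : Type u} [AddCommGroup M] [Module R M]
    [AddCommGroup N] [Module R N]
    (h : letI := moduleStructure R M
      letI := moduleStructure R N
      Nonempty (M ≃[moduleLang R] N)) : Nonempty (M ≃ₗ[R] N) := by
  let := moduleStructure R M
  let := moduleStructure R N
  obtain ⟨e⟩ := h
  exact ⟨{ e.toEquiv with
    map_add' := fun a b => e.map_fun' (ModuleFunc.add : (moduleLang R).Functions 2) ![a, b]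
    map_smul' := fun r a => e.map_fun' (ModuleFunc.smul r : (moduleLang R).Functions 1) ![a] }⟩

theorem nonempty_linearEquiv_of_categorical {κ : Cardinal.{u}}
    (h : κ.Categorical (freeTheory R)) {M N : Type u} [AddCommGroup M] [Module R M]
    [AddCommGroup N] [Module R N] (hM : PPGeneric R M) (hN : PPGeneric R N) (hMκ : #M = κ)
    (hNκ : #N = κ) : Nonempty (M ≃ₗ[R] N) := by
  let := moduleStructure R M
  let := moduleStructure R N
  have := hM.models
  have := hN.models
  exact nonempty_linearEquiv_of_equiv
    (h (Language.Theory.ModelType.of _ M) (Language.Theory.ModelType.of _ N) hMκ hNκ)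

/-- An index set of cardinality `τ⁺`. -/
abbrev SuccTau (R : Type u) : Type u := (Order.succ (tau R)).out

theorem mk_succTau (R : Type u) : #(SuccTau R) = Order.succ (tau R) := mk_out _

theorem aleph0_lt_succ_tau (R : Type u) : ℵ₀ < Order.succ (tau R) :=
  Order.lt_succ_of_le (aleph0_le_tau R)

instance (R : Type u) : Infinite (SuccTau R) :=
  infinite_iff.2 (by rw [mk_succTau]; exact (aleph0_lt_succ_tau R).le)

theorem mk_le_succ_tau (R : Type u) : #R ≤ Order.succ (tau R) :=
  (mk_le_tau R).trans (Order.le_succ _)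

theorem mk_succTau_finsupp [Nontrivial R] : #(SuccTau R →₀ R) = Order.succ (tau R) := by
  rw [mk_finsupp_of_infinite, mk_succTau, max_eq_left (mk_le_succ_tau R)]

theorem nonempty_prod_linearEquiv [Nontrivial R]
    (h : (Order.succ (tau R)).Categorical (freeTheory R)) {F : Type u} [AddCommGroup F]
    [Module R F] (hF : RLike R F) (X : Type u) [Infinite X]
    (hc : #(F × (X →₀ R)) = Order.succ (tau R)) :
    Nonempty ((F × (X →₀ R)) ≃ₗ[R] (SuccTau R →₀ R)) :=
  nonempty_linearEquiv_of_categorical h (ppGeneric_prod_finsupp hF X)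
    (ppGeneric_finsupp (SuccTau R)) hc mk_succTau_finsupp

theorem exists_retract_free [Nontrivial R]
    (h : (Order.succ (tau R)).Categorical (freeTheory R)) {F : Type u} [AddCommGroup F]
    [Module R F] (hF : RLike R F) (hc : #F ≤ tau R) :
    ∃ (i : F →ₗ[R] SuccTau R →₀ R) (p : (SuccTau R →₀ R) →ₗ[R] F), ∀ x, p (i x) = x := by
  have hcard : #(F × (SuccTau R →₀ R)) = Order.succ (tau R) := by
    rw [mk_prod, lift_id, lift_id, mk_succTau_finsupp,
      mul_eq_right (aleph0_lt_succ_tau R).le (hc.trans (Order.le_succ _)) (mk_ne_zero F)]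
  obtain ⟨e⟩ := nonempty_prod_linearEquiv h hF (SuccTau R) hcard
  exact ⟨e.toLinearMap ∘ₗ LinearMap.inl R _ _, LinearMap.fst R _ _ ∘ₗ e.symm.toLinearMap,
    fun x => by simp⟩

/-- Identify `F^(τ⁺) × R^(ℕ)` with `R^(τ⁺)`. The countable part touches only countably many
coordinates; at an untouched coordinate `y` the functional vanishes on it, so the value 1 at the
basis vector `y` comes from `F^(τ⁺)` alone. -/
theorem exists_sum_eq_one [Nontrivial R]
    (h : (Order.succ (tau R)).Categorical (freeTheory R)) {F : Type u} [AddCommGroup F]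
    [Module R F] [Nontrivial F] (hF : RLike R F) (hc : #F ≤ tau R) :
    ∃ (s : Finset (SuccTau R)) (g : SuccTau R → F →ₗ[R] R) (f : SuccTau R → F),
      ∑ c ∈ s, g c (f c) = 1 := by
  classical
  have hcard : #((SuccTau R →₀ F) × (ULift.{u} ℕ →₀ R)) = Order.succ (tau R) := by
    rw [mk_prod, lift_id, lift_id, mk_finsupp_of_infinite, mk_finsupp_of_infinite, mk_succTau,
      max_eq_left (hc.trans (Order.le_succ _))]
    refine mul_eq_left (aleph0_lt_succ_tau R).le (max_le ?_ (mk_le_succ_tau R)) ?_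
    · simpa using (aleph0_lt_succ_tau R).le
    · exact (lt_of_lt_of_le (pos_iff_ne_zero.2 (mk_ne_zero (ULift.{u} ℕ))) (le_max_left _ _)).ne'
  obtain ⟨e⟩ := nonempty_prod_linearEquiv h (hF.finsupp (SuccTau R)) (ULift.{u} ℕ) hcard
  let d : ULift.{u} ℕ → SuccTau R →₀ R := fun k => e (0, Finsupp.single k 1)
  have hcount : (⋃ k, ((d k).support : Set (SuccTau R))).Countable :=
    Set.countable_iUnion fun k => Finset.countable_toSet _
  obtain ⟨y, hy⟩ : ∃ y, y ∉ ⋃ k, ((d k).support : Set (SuccTau R)) := by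
    by_contra! hall
    have h1 : #(SuccTau R) ≤ ℵ₀ := by
      rw [← mk_univ, le_aleph0_iff_set_countable]
      exact hcount.mono fun y _ => hall y
    rw [mk_succTau] at h1
    exact absurd h1 (not_le.2 (aleph0_lt_succ_tau R))
  have hzero : ∀ w : ULift.{u} ℕ →₀ R, e (0, w) y = 0 := by
    have : Finsupp.lapply y ∘ₗ e.toLinearMap ∘ₗ LinearMap.inr R (SuccTau R →₀ F) _ = 0 := by
      refine Finsupp.lhom_ext' fun k => LinearMap.ext_ring ?_
      have := fun hk => hy (Set.mem_iUnion.2 ⟨k, hk⟩)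
      simpa [d] using this
    exact fun w => LinearMap.congr_fun this w
  obtain ⟨⟨v, w⟩, hv⟩ := e.surjective (Finsupp.single y 1)
  let g : (SuccTau R →₀ F) →ₗ[R] R :=
    Finsupp.lapply y ∘ₗ e.toLinearMap ∘ₗ LinearMap.inl R _ _
  have hg : g v = 1 := by
    have h1 : e (v, 0) + e (0, w) = Finsupp.single y 1 := by
      rw [← map_add, Prod.mk_add_mk, add_zero, zero_add, hv]
    have h2 := DFunLike.congr_fun h1 y
    rw [Finsupp.add_apply, hzero, add_zero, Finsupp.single_eq_same] at h2
    exact h2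
  refine ⟨v.support, fun c => g ∘ₗ Finsupp.lsingle c, v, ?_⟩
  rw [← hg]
  conv_rhs => rw [← Finsupp.sum_single v, Finsupp.sum, map_sum]
  rfl

/-- The class of `b` in `R^ℕ / R^(ℕ)` is divisible by every `b m`, with quotient the class of `tail
m`. Inside a small pure submodule, a retract of a free module, its finitely many coordinates thus
lie in every `b n R`. Expressing `b` through them modulo finite support puts `b k` in all these
right ideals at once, for a large `k` independent of `n`. -/
theorem exists_mem_mul_of_categorical [Nontrivial R]
    (h : (Order.succ (tau R)).Categorical (freeTheory R)) (b : ℕ → R)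
    (hb : ∀ n, ∃ a, b (n + 1) = b n * a) : ∃ k, ∀ n, ∃ r, b k = b n * r := by
  classical
  choose a ha using hb
  let tail : ℕ → ℕ → R := fun m k =>
    if k < m then 0 else ((List.range' m (k - m)).map a).prod
  have htail : ∀ m k, m ≤ k → b m * tail m k = b k := by
    intro m k hmk
    obtain ⟨j, rfl⟩ := Nat.exists_eq_add_of_le hmk
    induction j with
    | zero => simp [tail]
    | succ j ih =>
      have h1 := ih (Nat.le_add_right m j)
      simp only [tail, not_lt.2 (Nat.le_add_right _ _), if_false, Nat.add_sub_cancel_left] at h1 ⊢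
      rw [List.range'_concat, List.map_append, List.prod_append, ← mul_assoc, h1]
      simp [← add_assoc, ha]
  set N := LinearMap.range (Finsupp.lcoeFun : (ℕ →₀ R) →ₗ[R] ℕ → R) with hN
  have hfin : ∀ w : ℕ → R, N.mkQ w = 0 → ∃ k₀, ∀ k ≥ k₀, w k = 0 := by
    intro w hw
    rw [← LinearMap.mem_ker, Submodule.ker_mkQ] at hw
    obtain ⟨l, rfl⟩ := hw
    refine ⟨l.support.sup id + 1, fun k hk => ?_⟩
    by_contra hne
    have := Finset.le_sup (f := id) (Finsupp.mem_support_iff.2 hne)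
    simp only [id] at this
    omega
  have hfin' : ∀ w : ℕ → R, (∃ k₀, ∀ k ≥ k₀, w k = 0) → N.mkQ w = 0 := by
    rintro w ⟨k₀, hk₀⟩
    rw [← LinearMap.mem_ker, Submodule.ker_mkQ]
    refine ⟨Finsupp.onFinset (Finset.range k₀) w fun k hk => ?_, rfl⟩
    by_contra hne
    exact hk (hk₀ k (by simpa using hne))
  have hrlike : RLike R ((ℕ → R) ⧸ N) :=
    (pureMono_finsupp_pi ℕ).rlike_quotient (RLike.pi fun _ => RLike.self)
  obtain ⟨L, hL, hpure, hLc⟩ := exists_small_pure (Set.range fun m => N.mkQ (tail m))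
    ((le_aleph0_iff_set_countable.2 (Set.countable_range _)).trans (aleph0_le_tau R))
  obtain ⟨i, p, hip⟩ := exists_retract_free h (hpure.rlike hrlike) hLc
  have hsmul : ∀ m, b m • N.mkQ (tail m) = N.mkQ b := by
    intro m
    rw [← map_smul, ← sub_eq_zero, ← map_sub]
    exact hfin' _ ⟨m, fun k hk => by simp [htail m k hk]⟩
  let z : ℕ → L := fun m => ⟨N.mkQ (tail m), hL ⟨m, rfl⟩⟩
  have hβ : N.mkQ b ∈ L := by
    rw [← hsmul 0]
    exact L.smul_mem _ (z 0).2
  have hz : ∀ m, b m • z m = ⟨N.mkQ b, hβ⟩ := fun m => Subtype.ext (hsmul m)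
  set c := i ⟨N.mkQ b, hβ⟩ with hc
  have hdvd : ∀ n y, c y = b n * i (z n) y := by
    intro n y
    rw [hc, ← hz n, map_smul, Finsupp.smul_apply, smul_eq_mul]
  choose w hw using fun y => N.mkQ_surjective (p (Finsupp.single y 1) : (ℕ → R) ⧸ N)
  have hsum : N.mkQ (b - ∑ y ∈ c.support, c y • w y) = 0 := by
    have h1 : ⟨N.mkQ b, hβ⟩ = ∑ y ∈ c.support, c y • p (Finsupp.single y 1) := by
      rw [← hip ⟨N.mkQ b, hβ⟩, ← hc]
      conv_lhs => rw [← Finsupp.sum_single c, Finsupp.sum, map_sum]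
      refine Finset.sum_congr rfl fun y _ => ?_
      rw [← map_smul, Finsupp.smul_single, smul_eq_mul, mul_one]
    have h2 := congrArg L.subtype h1
    rw [map_sum] at h2
    rw [map_sub, sub_eq_zero, map_sum]
    refine h2.trans (Finset.sum_congr rfl fun y _ => ?_)
    rw [map_smul, map_smul, hw]
    rfl
  obtain ⟨k, hk⟩ := hfin _ hsum
  refine ⟨k, fun n => ⟨∑ y ∈ c.support, i (z n) y * w y k, ?_⟩⟩
  have h1 := hk k le_rfl
  simp only [Pi.sub_apply, Finset.sum_apply, Pi.smul_apply, smul_eq_mul, sub_eq_zero] at h1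
  rw [h1, Finset.mul_sum]
  refine Finset.sum_congr rfl fun y _ => ?_
  rw [hdvd n y, mul_assoc]

end Categoricity

/-! ### Chain condition, minimal idempotents and local corner rings. -/

section Idempotents

variable {R : Type*} [Ring R]

/-- The descending chain condition on principal right ideals. -/
def PrincipalRightDCC (R : Type*) [Ring R] : Prop :=
  ∀ b : ℕ → R, (∀ n, ∃ a, b (n + 1) = b n * a) → ∃ k, ∀ n, ∃ r, b k = b n * r

theorem PrincipalRightDCC.exists_minimal (h : PrincipalRightDCC R) {s : Set R} (hs : s.Nonempty) :
    ∃ m ∈ s, ∀ x ∈ s, (∃ a, x = m * a) → ∃ r, m = x * r := by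
  by_contra! hcon
  obtain ⟨m₀, hm₀⟩ := hs
  choose f hf using hcon
  let g : s → s := fun m => ⟨f m m.2, (hf m m.2).1⟩
  let b : ℕ → s := fun n => g^[n] ⟨m₀, hm₀⟩
  have hb : ∀ n, b (n + 1) = g (b n) := fun n => Function.iterate_succ_apply' g n _
  obtain ⟨k, hk⟩ := h (fun n => b n) fun n => by
    obtain ⟨a, ha⟩ := (hf (b n) (b n).2).2.1
    exact ⟨a, by rw [hb]; exact ha⟩
  obtain ⟨r, hr⟩ := hk (k + 1)
  rw [hb] at hr
  exact (hf (b k) (b k).2).2.2 r hr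

/-- An idempotent `e ≠ 0` for which `e R` is minimal among the nonzero right ideals generated by
an idempotent. -/
structure IsMinimalIdempotent (e : R) : Prop where
  idem : e * e = e
  ne_zero : e ≠ 0
  minimal : ∀ f : R, f * f = f → f ≠ 0 → (∃ a, f = e * a) → ∃ r, e = f * r

theorem PrincipalRightDCC.exists_isMinimalIdempotent [Nontrivial R] (h : PrincipalRightDCC R) :
    ∃ e : R, IsMinimalIdempotent e := by
  obtain ⟨e, ⟨h1, h2⟩, h3⟩ := h.exists_minimal (s := {e : R | e * e = e ∧ e ≠ 0})
    ⟨1, by simp, one_ne_zero⟩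
  exact ⟨e, h1, h2, fun f hf hf0 => h3 f ⟨hf, hf0⟩⟩

/-- The element `x` is invertible in the corner ring `e R e`. -/
def InvertibleIn (e x : R) : Prop := ∃ t, e * t = t ∧ t * e = t ∧ x * t = e ∧ t * x = e

theorem IsMinimalIdempotent.eq_of_idem {e f : R} (he : IsMinimalIdempotent e) (hf : f * f = f)
    (hf0 : f ≠ 0) (h1 : e * f = f) (h2 : f * e = f) : f = e := by
  obtain ⟨r, hr⟩ := he.minimal f hf hf0 ⟨f, h1.symm⟩
  rw [← h2, hr, ← mul_assoc, hf]

/-- Writing `(1 - u) ^ n = 1 - u * q` turns nilpotency of `u * u - u` into `u ^ n = u ^ n * (u *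
q)`, so `(u * q) ^ n` is idempotent; were it zero, `u ^ n` would vanish. -/
theorem exists_idempotent_of_isNilpotent {u : R} (hu : ¬ IsNilpotent u)
    (h : IsNilpotent (u * u - u)) : ∃ p : R, Commute u p ∧
      (u * p) * (u * p) = u * p ∧ u * p ≠ 0 := by
  obtain ⟨n, hn⟩ := h
  obtain ⟨q, hq, hq'⟩ : ∃ q, Commute u q ∧ (1 - u) ^ n = 1 - u * q := by
    clear hn
    induction n with
    | zero => exact ⟨0, Commute.zero_right _, by simp⟩
    | succ n ih =>
      obtain ⟨q, hq, hq'⟩ := ih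
      refine ⟨1 + q - q * u, ?_, ?_⟩
      · exact ((Commute.one_right _).add_right hq).sub_right (hq.mul_right (Commute.refl _))
      · rw [pow_succ, hq']
        noncomm_ring
  have h1 : u ^ n = u ^ n * (u * q) := by
    have h2 : u * u - u = -(u * (1 - u)) := by noncomm_ring
    have h3 : Commute u (1 - u) := (Commute.one_right _).sub_right (Commute.refl _)
    rw [h2, neg_pow, h3.mul_pow, hq', mul_sub, mul_one] at hn
    have h4 : (-1 : R) ^ n * ((-1) ^ n * (u ^ n - u ^ n * (u * q))) = 0 := by rw [hn, mul_zero]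
    rw [← mul_assoc, ← pow_add, Even.neg_one_pow ⟨n, rfl⟩, one_mul, sub_eq_zero] at h4
    exact h4
  have huq : Commute u (u * q) := (Commute.refl _).mul_right hq
  have h5 : ∀ m, u ^ n = u ^ n * (u * q) ^ m := by
    intro m
    induction m with
    | zero => simp
    | succ m ih => rw [pow_succ, ← mul_assoc, ← ih, ← h1]
  have hn0 : n ≠ 0 := by
    rintro rfl
    rw [pow_zero] at hn
    have : Subsingleton R := subsingleton_of_zero_eq_one hn.symm
    exact hu ⟨0, Subsingleton.elim _ _⟩
  obtain ⟨m, rfl⟩ := Nat.exists_eq_succ_of_ne_zero hn0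
  have h6 : u * (u ^ m * q ^ (m + 1)) = (u * q) ^ (m + 1) := by
    rw [hq.mul_pow, ← mul_assoc, ← pow_succ']
  refine ⟨u ^ m * q ^ (m + 1), ?_, ?_, ?_⟩
  · exact ((Commute.refl u).pow_right _).mul_right (hq.pow_right _)
  · have h7 : (u * q) ^ (m + 1) = q ^ (m + 1) * u ^ (m + 1) := by
      rw [hq.mul_pow, (hq.pow_pow _ _).eq]
    rw [h6]
    nth_rewrite 1 [h7]
    rw [mul_assoc, ← h5 (m + 1), ← h7]
  · intro h0
    rw [h6] at h0
    have := h5 (m + 1)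
    rw [h0, mul_zero] at this
    exact hu ⟨_, this⟩

/-- For non-nilpotent `x`, take a minimal non-nilpotent `z` in `x R` within the corner. Minimality
against `z * z` yields `u` in `z R` with `z * u = z`, and against `u * u - u`, killed by `z`, shows
the latter nilpotent. The resulting idempotent multiple of `u` must be `e`, so `x` has a right
inverse in the corner; it is two-sided by minimality again. -/
theorem IsMinimalIdempotent.isNilpotent_or_invertibleIn (h : PrincipalRightDCC R) {e x : R}
    (he : IsMinimalIdempotent e) (h1 : e * x = x) (h2 : x * e = x) :
    IsNilpotent x ∨ InvertibleIn e x := by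
  by_contra! hcon
  obtain ⟨hx, hinv⟩ := hcon
  obtain ⟨z, ⟨hez, hze, hz, a, rfl⟩, hmin⟩ := h.exists_minimal
    (s := {z : R | e * z = z ∧ z * e = z ∧ ¬ IsNilpotent z ∧ ∃ a, z = x * a})
    ⟨x, h1, h2, hx, 1, by simp⟩
  set z := x * a with hzdef
  have hz2 : ¬ IsNilpotent (z * z) := fun ⟨n, hn⟩ => hz ⟨2 * n, by rw [pow_mul, sq, hn]⟩
  obtain ⟨w, hw⟩ := hmin (z * z) ⟨by rw [← mul_assoc, hez], by rw [mul_assoc, hze], hz2, a * z,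
    by rw [hzdef]; noncomm_ring⟩ ⟨z, rfl⟩
  obtain ⟨u, hu, heu, hue, w', hw'⟩ : ∃ u, z * u = z ∧ e * u = u ∧ u * e = u ∧ ∃ w', u = z * w' := by
    refine ⟨z * w * e, ?_, ?_, ?_, w * e, mul_assoc _ _ _⟩
    · rw [← mul_assoc, ← mul_assoc, ← hw, hze]
    · rw [← mul_assoc, ← mul_assoc, hez]
    · rw [mul_assoc, he.idem]
  have hzu : ∀ m, z * u ^ m = z := by
    intro m
    induction m with
    | zero => simp
    | succ m ih => rw [pow_succ, ← mul_assoc, ih, hu]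
  have hun : ¬ IsNilpotent u := by
    rintro ⟨m, hm⟩
    have := hzu m
    rw [hm, mul_zero] at this
    exact hz ⟨1, by rw [← this, pow_one]⟩
  have hnil : IsNilpotent (u * u - u) := by
    by_contra hk
    have hzk : z * (u * u - u) = 0 := by rw [mul_sub, ← mul_assoc, hu, hu, sub_self]
    obtain ⟨s, hs⟩ := hmin (u * u - u) ⟨by rw [mul_sub, ← mul_assoc, heu],
      by rw [sub_mul, mul_assoc, hue], hk, a * (w' * u - w'), by
        rw [← mul_assoc, ← hzdef, mul_sub, ← mul_assoc, ← hw']⟩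
      ⟨w' * u - w', by rw [mul_sub, ← mul_assoc, ← hw']⟩
    apply hz2
    have : z * z = 0 := by
      nth_rewrite 2 [hs]
      rw [← mul_assoc, hzk, zero_mul]
    rw [this]
    exact IsNilpotent.zero
  obtain ⟨p, hp, hf, hf0⟩ := exists_idempotent_of_isNilpotent hun hnil
  have hfe : u * p = e := he.eq_of_idem hf hf0 (by rw [← mul_assoc, heu])
    (by rw [hp.eq, mul_assoc, hue])
  obtain ⟨t, ht⟩ : ∃ t, x * t = e := ⟨a * (w' * p), by
    rw [← mul_assoc, ← hzdef, ← mul_assoc, ← hw', hfe]⟩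
  have hxt : x * (e * t * e) = e := by
    rw [← mul_assoc, ← mul_assoc, h2, ht, he.idem]
  have het : e * (e * t * e) = e * t * e := by rw [← mul_assoc, ← mul_assoc, he.idem]
  have hte : (e * t * e) * e = e * t * e := by rw [mul_assoc, he.idem]
  refine hinv ⟨e * t * e, het, hte, hxt, ?_⟩
  refine he.eq_of_idem ?_ ?_ (by rw [← mul_assoc, het]) (by rw [mul_assoc, h2])
  · rw [mul_assoc, ← mul_assoc x, hxt, h1]
  · intro h0
    have : x = 0 := by
      rw [← h1, ← hxt, mul_assoc, h0, mul_zero]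
    exact hx (this ▸ IsNilpotent.zero)

theorem IsMinimalIdempotent.invertibleIn_of_add (h : PrincipalRightDCC R) {e a b : R}
    (he : IsMinimalIdempotent e) (ha : e * a = a) (ha' : a * e = a) (hb : e * b = b)
    (hab : InvertibleIn e (a + b)) : InvertibleIn e a ∨ InvertibleIn e b := by
  obtain ⟨t, h1, h2, h3, h4⟩ := hab
  have ht : t * a + t * b = e := by rw [← mul_add, h4]
  have hc : e * (t * a) = t * a := by rw [← mul_assoc, h1]
  have hc' : t * a * e = t * a := by rw [mul_assoc, ha']
  rcases he.isNilpotent_or_invertibleIn h hc hc' with ⟨n, hn⟩ | ⟨s, hs1, hs2, hs3, hs4⟩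
  · right
    set c := t * a
    -- The geometric series inverts `1 - c`, and `t * b` is `(1 - c) * e`.
    set g := ∑ i ∈ Finset.range n, c ^ i
    have hg1 : (1 - c) * g = 1 := by rw [mul_neg_geom_sum, hn, sub_zero]
    have hg2 : g * (1 - c) = 1 := by rw [geom_sum_mul_neg, hn, sub_zero]
    have hce : Commute e c := hc.trans hc'.symm
    have hge : Commute e g := Commute.sum_right _ _ _ fun i _ => hce.pow_right i
    have htb : t * b = (1 - c) * e := by rw [sub_mul, one_mul, hc', ← ht, add_sub_cancel_left]
    have htb' : t * b = e * (1 - c) := by rw [mul_sub, mul_one, hc, ← ht, add_sub_cancel_left]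
    refine ⟨e * g * t, by rw [← mul_assoc, ← mul_assoc, he.idem], by rw [mul_assoc, h2], ?_, ?_⟩
    · have : b = (a + b) * (t * b) := by rw [← mul_assoc, h3, hb]
      rw [this, mul_assoc, ← mul_assoc (t * b), ← mul_assoc (t * b), htb, mul_assoc (1 - c),
        he.idem, mul_assoc (1 - c), hge.eq, ← mul_assoc (1 - c), hg1, one_mul, h1, h3]
    · rw [mul_assoc, htb, ← mul_assoc, mul_assoc e, hg2, mul_one, he.idem]
  · left
    refine ⟨s * t, by rw [← mul_assoc, hs1], by rw [mul_assoc, h2], ?_, by rw [mul_assoc, hs4]⟩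
    have : a = (a + b) * (t * a) := by rw [← mul_assoc, h3, ha]
    rw [this, mul_assoc, ← mul_assoc (t * a), hs3, h1, h3]

theorem IsMinimalIdempotent.exists_invertibleIn_of_sum (h : PrincipalRightDCC R) {e : R}
    (he : IsMinimalIdempotent e) {ι : Type*} (s : Finset ι) (x : ι → R)
    (h1 : ∀ c, e * x c = x c) (h2 : ∀ c, x c * e = x c) (hs : InvertibleIn e (∑ c ∈ s, x c)) :
    ∃ c ∈ s, InvertibleIn e (x c) := by
  classical
  induction s using Finset.induction_on with
  | empty =>
    obtain ⟨t, -, -, ht, -⟩ := hs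
    exact absurd (by simpa using ht.symm) he.ne_zero
  | insert c s hc ih =>
    rw [Finset.sum_insert hc] at hs
    rcases he.invertibleIn_of_add h (h1 c) (h2 c) (by simp [Finset.mul_sum, h1]) hs with h3 | h3
    · exact ⟨c, Finset.mem_insert_self _ _, h3⟩
    · obtain ⟨d, hd, h4⟩ := ih h3
      exact ⟨d, Finset.mem_insert_of_mem hd, h4⟩

end Idempotents

/-! ### Decomposition into copies of a universal summand. -/

section Decomposition

variable {R : Type u} [Ring R]

/-- The left ideal `R e` for an idempotent `e`. -/
def cornerIdeal (e : R) : Submodule R R where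
  carrier := {x | x * e = x}
  add_mem' ha hb := by
    change (_ + _) * e = _
    rw [add_mul]
    exact congrArg₂ _ ha hb
  zero_mem' := zero_mul e
  smul_mem' r x hx := by
    change r * x * e = _
    rw [mul_assoc]
    exact congrArg _ hx

theorem mem_cornerIdeal {e x : R} : x ∈ cornerIdeal e ↔ x * e = x := Iff.rfl

/-- The retraction `x ↦ x e` of `R` onto `R e`. -/
def cornerRetraction {e : R} (he : e * e = e) : R →ₗ[R] cornerIdeal e :=
  (LinearMap.toSpanSingleton R R e).codRestrict _ fun x => by
    rw [mem_cornerIdeal, LinearMap.toSpanSingleton_apply, smul_eq_mul, mul_assoc, he]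

theorem coe_cornerRetraction {e : R} (he : e * e = e) (x : R) :
    (cornerRetraction he x : R) = x * e := rfl

theorem projective_cornerIdeal {e : R} (he : e * e = e) :
    Module.Projective R (cornerIdeal e) := by
  refine Module.Projective.of_split (cornerIdeal e).subtype (cornerRetraction he) ?_
  ext x
  exact x.2

/-- The module `P` is nonzero, projective, and a direct summand of every small nonzero module
satisfying the positive primitive implications of `R`. -/
structure IsUniversalSummand (R : Type u) [Ring R] (P : Type u) [AddCommGroup P] [Module R P] :
    Prop where
  projective : Module.Projective R P
  nontrivial : Nontrivial P
  summand : ∀ (F : Type u) [AddCommGroup F] [Module R F] [Nontrivial F], RLike R F → #F ≤ tau R →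
    ∃ (f : P →ₗ[R] F) (g : F →ₗ[R] P), ∀ x, g (f x) = x

/-- Compressing a trace relation `∑ g c (f c) = 1` by `e` gives a sum equal to `e`; locality makes
one term invertible in the corner, and its inverse splits `x ↦ x • f c`. -/
theorem isUniversalSummand_cornerIdeal [Nontrivial R]
    (h : (Order.succ (tau R)).Categorical (freeTheory R)) {e : R} (he : IsMinimalIdempotent e) :
    IsUniversalSummand R (cornerIdeal e) where
  projective := projective_cornerIdeal he.idem
  nontrivial := ⟨⟨e, he.idem⟩, 0, fun h0 => he.ne_zero (congrArg Subtype.val h0)⟩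
  summand F _ _ _ hF hc := by
    obtain ⟨s, g, f, hs⟩ := exists_sum_eq_one h hF hc
    obtain ⟨c, -, t, ht1, ht2, ht3, -⟩ :=
      he.exists_invertibleIn_of_sum (exists_mem_mul_of_categorical h) s (fun c => e * g c (f c) * e)
        (fun c => by rw [← mul_assoc, ← mul_assoc, he.idem])
        (fun c => by rw [mul_assoc, he.idem])
        (by
          rw [← Finset.sum_mul, ← Finset.mul_sum, hs, mul_one, he.idem]
          exact ⟨e, he.idem, he.idem, he.idem, he.idem⟩)
    have hxt : ∀ x : cornerIdeal e, (x : R) * g c (f c) * t = x := by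
      intro x
      have hx : (x : R) * e = x := x.2
      calc (x : R) * g c (f c) * t = x * e * g c (f c) * (e * t) := by rw [hx, ht1]
        _ = x * (e * g c (f c) * e * t) := by noncomm_ring
        _ = x := by rw [ht3, hx]
    refine ⟨LinearMap.toSpanSingleton R F (f c) ∘ₗ (cornerIdeal e).subtype,
      cornerRetraction he.idem ∘ₗ LinearMap.toSpanSingleton R R t ∘ₗ g c, fun x => ?_⟩
    apply Subtype.ext
    simp only [LinearMap.comp_apply, LinearMap.toSpanSingleton_apply,
      Submodule.subtype_apply, map_smul, smul_eq_mul]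
    rw [Submodule.coe_smul, coe_cornerRetraction, smul_eq_mul, ← mul_assoc, ← mul_assoc, hxt]
    exact x.2

/-- The evaluation map out of the direct sum of copies of `P` indexed by `P →ₗ[R] M`. -/
noncomputable def homEval (R : Type u) [Ring R] (P M : Type u) [AddCommGroup P] [Module R P]
    [AddCommGroup M] [Module R M] : ((P →ₗ[R] M) →₀ P) →ₗ[R] M :=
  Finsupp.lsum ℕ fun h : P →ₗ[R] M => h

theorem homEval_single {P M : Type u} [AddCommGroup P] [Module R P]
    [AddCommGroup M] [Module R M] (h : P →ₗ[R] M) (x : P) :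
    homEval R P M (Finsupp.single h x) = h x := by
  simp [homEval]

/-- The evaluation map out of the direct sum of copies of `P` indexed by a set of linear maps. -/
noncomputable def homEvalOn {P M : Type u} [AddCommGroup P] [Module R P]
    [AddCommGroup M] [Module R M] (s : Set (P →ₗ[R] M)) :
    Finsupp.supported P R s →ₗ[R] M :=
  homEval R P M ∘ₗ (Finsupp.supported P R s).subtype

theorem pureMono_homEvalOn_sUnion {P M : Type u} [AddCommGroup P] [Module R P]
    [AddCommGroup M] [Module R M] {c : Set (Set (P →ₗ[R] M))} (hne : c.Nonempty)
    (hc : IsChain (· ⊆ ·) c) (h : ∀ s ∈ c, PureMono (homEvalOn s)) :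
    PureMono (homEvalOn (⋃₀ c)) := by
  classical
  rintro S ⟨y, hy⟩
  let T : Finset (P →ₗ[R] M) := S.toFinset.biUnion fun p => (p.2 : (P →ₗ[R] M) →₀ P).support
  have hT : (T : Set (P →ₗ[R] M)) ⊆ ⋃₀ c := by
    intro f hf
    obtain ⟨p, -, hp⟩ := Finset.mem_biUnion.1 hf
    exact (Finsupp.mem_supported R _).1 p.2.2 hp
  rw [Set.sUnion_eq_biUnion] at hT
  obtain ⟨s, hs, hTs⟩ :=
    DirectedOn.exists_mem_subset_of_finset_subset_biUnion (f := id) hne hc.directedOn hT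
  have hmem : ∀ p ∈ S, (p.2 : (P →ₗ[R] M) →₀ P) ∈ Finsupp.supported P R s := fun p hp =>
    (Finsupp.mem_supported R _).2 fun f hf =>
      hTs (Finset.mem_biUnion.2 ⟨p, List.mem_toFinset.2 hp, hf⟩)
  let restrict : (ℕ →₀ R) × Finsupp.supported P R (⋃₀ c) → (ℕ →₀ R) × Finsupp.supported P R s :=
    fun p => (p.1, if hp : (p.2 : (P →ₗ[R] M) →₀ P) ∈ Finsupp.supported P R s then ⟨p.2, hp⟩ else 0)
  obtain ⟨z, hz⟩ := h s hs (S.map restrict)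
    ⟨y, List.forall_mem_map.2 fun p hp => by
      simp only [restrict, dif_pos (hmem p hp)]
      exact hy p hp⟩
  let incl := Submodule.inclusion
    (Finsupp.supported_mono (M := P) (R := R) (Set.subset_sUnion_of_mem hs))
  refine ⟨fun k => incl (z k), fun p hp => ?_⟩
  have hz' := List.forall_mem_map.1 hz p hp
  simp only [restrict] at hz'
  rw [map_linearCombination, hz']
  simp only [dif_pos (hmem p hp)]
  rfl

theorem pureMono_homEvalOn_insert {P M : Type u} [AddCommGroup P] [Module R P]
    [AddCommGroup M] [Module R M] {s : Set (P →ₗ[R] M)} (hs : PureMono (homEvalOn s))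
    {h : P →ₗ[R] M} (hh : PureMono ((LinearMap.range (homEvalOn s)).mkQ ∘ₗ h)) :
    PureMono (homEvalOn (insert h s)) := by
  classical
  let σ : Finsupp.supported P R s × P →ₗ[R] Finsupp.supported P R (insert h s) :=
    ((Finsupp.supported P R s).subtype.coprod (Finsupp.lsingle h)).codRestrict _ fun x => by
      refine Submodule.add_mem _ ?_ ?_
      · exact Finsupp.supported_mono (Set.subset_insert _ _) x.1.2
      · exact Finsupp.single_mem_supported R _ (Set.mem_insert _ _)
  -- Only surjectivity of `σ` is used, so `h ∉ s` need not be known.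
  refine PureMono.of_comp_surjective (σ := σ) ?_ ?_
  · rintro ⟨a, ha⟩
    refine ⟨(⟨a.erase h, ?_⟩, a h), Subtype.ext (Finsupp.erase_add_single h a)⟩
    rw [Finsupp.mem_supported] at ha ⊢
    intro f hf
    rw [Finset.mem_coe, Finsupp.support_erase, Finset.mem_erase] at hf
    exact (ha hf.2).resolve_left hf.1
  · have : homEvalOn (insert h s) ∘ₗ σ = (homEvalOn s).coprod h := by
      refine LinearMap.ext fun x => ?_
      change homEval R P M ((x.1 : (P →ₗ[R] M) →₀ P) + Finsupp.single h x.2) = _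
      rw [map_add, homEval_single]
      rfl
    rw [this]
    exact hs.coprod hh

/-- Take a maximal `s` whose sum of copies of `P` is pure in `M`. A nonzero quotient would contain a
small pure submodule with summand `P`; lifting this `P` to `M` by projectivity enlarges `s`. -/
theorem IsUniversalSummand.exists_linearEquiv {P : Type u} [AddCommGroup P] [Module R P]
    (hP : IsUniversalSummand R P) {M : Type u} [AddCommGroup M] [Module R M] (hM : RLike R M) :
    ∃ ι : Type u, Nonempty (M ≃ₗ[R] (ι →₀ P)) := by
  have := hP.projective
  have := hP.nontrivial
  obtain ⟨s, hs⟩ := zorn_subset {s : Set (P →ₗ[R] M) | PureMono (homEvalOn s)} fun c hcS hc => by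
    rcases c.eq_empty_or_nonempty with rfl | hne
    · refine ⟨∅, ?_, by simp⟩
      rintro S -
      refine ⟨fun _ => 0, fun p _ => Subtype.ext ?_⟩
      have h0 := (Submodule.mem_bot R).1 (Finsupp.supported_empty.le p.2.2)
      simp [h0, Finsupp.linearCombination_apply]
    · exact ⟨⋃₀ c, pureMono_homEvalOn_sUnion hne hc hcS, fun t ht => Set.subset_sUnion_of_mem ht⟩
  have hpure : PureMono (homEvalOn s) := hs.prop
  have htop : LinearMap.range (homEvalOn s) = ⊤ := by
    by_contra hne
    have : Nontrivial (M ⧸ LinearMap.range (homEvalOn s)) :=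
      Submodule.Quotient.nontrivial_iff.2 hne
    obtain ⟨x, hx⟩ := exists_ne (0 : M ⧸ LinearMap.range (homEvalOn s))
    obtain ⟨L, hxL, hL, hLc⟩ := exists_small_pure {x}
      ((mk_singleton x).le.trans (one_le_aleph0.trans (aleph0_le_tau R)))
    have : Nontrivial L := ⟨⟨x, hxL rfl⟩, 0, fun h0 => hx (congrArg Subtype.val h0)⟩
    obtain ⟨f, g, hgf⟩ := hP.summand L (hL.rlike (hpure.rlike_quotient hM)) hLc
    have hf : PureMono (L.subtype ∘ₗ f) := hL.comp (PureMono.of_leftInverse g hgf)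
    obtain ⟨h, hh⟩ := Module.projective_lifting_property _ (L.subtype ∘ₗ f)
      (Submodule.mkQ_surjective (LinearMap.range (homEvalOn s)))
    have hins := pureMono_homEvalOn_insert hpure (h := h) (hh ▸ hf)
    have hmem : h ∈ s := hs.le_of_ge hins (Set.subset_insert _ _) (Set.mem_insert _ _)
    obtain ⟨p, hp⟩ := exists_ne (0 : P)
    apply hp
    apply hf.injective
    rw [map_zero, ← hh, LinearMap.comp_apply, Submodule.mkQ_apply,
      Submodule.Quotient.mk_eq_zero]
    exact ⟨⟨Finsupp.single h p, Finsupp.single_mem_supported R _ hmem⟩, homEval_single h p⟩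
  exact ⟨s, ⟨(LinearEquiv.ofBijective _ ⟨hpure.injective, LinearMap.range_eq_top.1 htop⟩).symm ≪≫ₗ
    Finsupp.supportedEquivFinsupp s⟩⟩

end Decomposition

/-! ### Freeness of powers, and the soft implications. -/

section Free

variable {R : Type u} [Ring R]

theorem IsUniversalSummand.exists_finite_linearEquiv [Nontrivial R] {P : Type u} [AddCommGroup P]
    [Module R P] (hP : IsUniversalSummand R P) :
    ∃ ι : Type u, Finite ι ∧ Nonempty ι ∧ Nonempty (R ≃ₗ[R] (ι →₀ P)) := by
  classical
  have := hP.nontrivial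
  obtain ⟨ι, ⟨e⟩⟩ := hP.exists_linearEquiv (RLike.self (R := R))
  refine ⟨ι, ?_, ?_, ⟨e⟩⟩
  · refine Set.finite_univ_iff.1 ((e 1).support.finite_toSet.subset fun c _ => ?_)
    obtain ⟨p, hp⟩ := exists_ne (0 : P)
    obtain ⟨r, hr⟩ := e.surjective (Finsupp.single c p)
    rw [Finset.mem_coe, Finsupp.mem_support_iff]
    intro h0
    apply hp
    have h1 := DFunLike.congr_fun hr c
    rw [← mul_one r, ← smul_eq_mul, map_smul, Finsupp.smul_apply, h0, smul_zero,
      Finsupp.single_eq_same] at h1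
    exact h1.symm
  · by_contra hne
    rw [not_nonempty_iff] at hne
    exact one_ne_zero (e.injective (Subsingleton.elim (e 1) (e 0)))

theorem free_finsupp_of_linearEquiv {P ι N : Type u} [AddCommGroup P] [Module R P] [Finite ι]
    [Nonempty ι] [Infinite N] (e : R ≃ₗ[R] (ι →₀ P)) : Module.Free R (N →₀ P) := by
  have hcard : #(N × ι) = #N := by
    rw [mk_prod, lift_id, lift_id]
    exact mul_eq_left (aleph0_le_mk N) ((lt_aleph0_of_finite ι).le.trans (aleph0_le_mk N))
      (mk_ne_zero ι)
  obtain ⟨f⟩ := Cardinal.eq.1 hcard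
  exact Module.Free.of_equiv
    (Finsupp.mapRange.linearEquiv e ≪≫ₗ (Finsupp.curryLinearEquiv R).symm ≪≫ₗ
      Finsupp.domLCongr f : (N →₀ R) ≃ₗ[R] (N →₀ P))

theorem PureMono.nonempty_prod_linearEquiv {A M : Type*} [AddCommGroup A] [Module R A]
    [AddCommGroup M] [Module R M] {f : A →ₗ[R] M} (hf : PureMono f)
    [Module.Projective R (M ⧸ LinearMap.range f)] :
    Nonempty ((A × (M ⧸ LinearMap.range f)) ≃ₗ[R] M) := by
  obtain ⟨s, hs⟩ := Module.projective_lifting_property (LinearMap.range f).mkQ LinearMap.id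
    (Submodule.mkQ_surjective _)
  have hs' : ∀ x, (LinearMap.range f).mkQ (s x) = x := LinearMap.congr_fun hs
  refine ⟨LinearEquiv.ofBijective (f.coprod s) ⟨(hf.coprod ?_).injective, fun x => ?_⟩⟩
  · exact PureMono.of_leftInverse LinearMap.id hs'
  · have hx : x - s ((LinearMap.range f).mkQ x) ∈ LinearMap.range f := by
      refine (Submodule.ker_mkQ (LinearMap.range f)).le (LinearMap.mem_ker.2 ?_)
      rw [map_sub, hs', sub_self]
    obtain ⟨a, ha⟩ := hx
    exact ⟨(a, (LinearMap.range f).mkQ x), by rw [LinearMap.coprod_apply, ha, sub_add_cancel]⟩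

theorem powersFree_of_categorical (h : (Order.succ (tau R)).Categorical (freeTheory R)) :
    PowersFree R := by
  classical
  intro I _
  cases subsingleton_or_nontrivial R
  · exact Module.Free.of_subsingleton' R _
  have hdcc : PrincipalRightDCC R := exists_mem_mul_of_categorical h
  obtain ⟨e, he⟩ := hdcc.exists_isMinimalIdempotent
  have hP := isUniversalSummand_cornerIdeal h he
  have := hP.projective
  obtain ⟨ι, _, _, ⟨e₁⟩⟩ := hP.exists_finite_linearEquiv
  have hpure := pureMono_finsupp_pi (R := R) I
  obtain ⟨ν, ⟨e₂⟩⟩ :=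
    hP.exists_linearEquiv (hpure.rlike_quotient (RLike.pi fun _ => RLike.self))
  have := Module.Projective.of_equiv (finsuppLequivDFinsupp (ι := ν) R (M := cornerIdeal e)).symm
  have := Module.Projective.of_equiv e₂.symm
  obtain ⟨e₃⟩ := hpure.nonempty_prod_linearEquiv
  have := free_finsupp_of_linearEquiv (N := (I × ι) ⊕ ν) e₁
  let e₄ : (I →₀ R) ≃ₗ[R] (I × ι →₀ cornerIdeal e) :=
    Finsupp.mapRange.linearEquiv e₁ ≪≫ₗ (Finsupp.curryLinearEquiv R).symm
  exact Module.Free.of_equiv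
    (Finsupp.sumFinsuppLEquivProdFinsupp R ≪≫ₗ (e₄.symm.prodCongr e₂.symm) ≪≫ₗ e₃)

theorem FreeElementary.allModelsFree (h : FreeElementary R) : AllModelsFree R := by
  obtain ⟨A, hA⟩ := h
  intro M _ hM
  refine (hA M).1 ⟨fun φ hφ => hM.realize_of_mem φ fun X _ => ?_⟩
  let := moduleStructure R (X →₀ R)
  exact ((hA (X →₀ R)).2 ⟨inferInstance, inferInstance, rfl, inferInstance⟩).realize_of_mem φ hφ

theorem nonempty_equiv_of_linearEquiv {M N : Type u} [AddCommGroup M] [Module R M]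
    [AddCommGroup N] [Module R N] (e : M ≃ₗ[R] N) :
    letI := moduleStructure R M
    letI := moduleStructure R N
    Nonempty (M ≃[moduleLang R] N) := by
  let := moduleStructure R M
  let := moduleStructure R N
  exact ⟨{ e.toEquiv with
    map_fun' := fun f x => by
      cases f with
      | zero => exact map_zero e
      | add => exact map_add e _ _
      | neg => exact map_neg e _
      | smul r => exact map_smul e r _
    map_rel' := fun r => r.elim }⟩

theorem mk_eq_of_basis {M B : Type u} [AddCommGroup M] [Module R M] (b : Module.Basis B R M)
    (h : Order.succ (tau R) ≤ #M) : #B = #M := by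
  have hlt : tau R < #M := Order.succ_le_iff.1 h
  have hM : #M = #(B →₀ R) := mk_congr b.repr.toEquiv
  have : Nontrivial R := by
    by_contra hR
    rw [not_nontrivial_iff_subsingleton] at hR
    have h1 : #M ≤ 1 := by
      rw [hM]
      exact le_one_iff_subsingleton.2 inferInstance
    exact absurd hlt (not_lt.2 (h1.trans (one_le_aleph0.trans (aleph0_le_tau R))))
  have : Infinite B := by
    by_contra hB
    rw [not_infinite_iff_finite] at hB
    have := Fintype.ofFinite B
    apply absurd hlt
    rw [not_lt, hM, mk_finsupp_of_fintype]
    exact (power_nat_le (aleph0_le_tau R)).trans' (power_le_power_right (mk_le_tau R))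
  rw [hM, mk_finsupp_of_infinite] at hlt ⊢
  rcases le_total #B #R with h1 | h1
  · rw [max_eq_right h1] at hlt
    exact absurd hlt (not_lt.2 (mk_le_tau R))
  · rw [max_eq_left h1]

theorem nonempty_equiv_of_isFreeModule {M N : Type u} [S : (moduleLang R).Structure M]
    [S' : (moduleLang R).Structure N] (hM : IsFreeModule R M) (hN : IsFreeModule R N)
    (h : Order.succ (tau R) ≤ #M) (hMN : #M = #N) : Nonempty (M ≃[moduleLang R] N) := by
  obtain ⟨_, _, rfl, hfM⟩ := hM
  obtain ⟨_, _, rfl, hfN⟩ := hN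
  let b := Module.Free.chooseBasis R M
  let c := Module.Free.chooseBasis R N
  obtain ⟨f⟩ := Cardinal.eq.1
    ((mk_eq_of_basis b h).trans (hMN.trans (mk_eq_of_basis c (hMN ▸ h)).symm))
  exact nonempty_equiv_of_linearEquiv (b.equiv c f)

theorem AllModelsFree.categorical (h : AllModelsFree R) {κ : Cardinal.{u}}
    (hκ : Order.succ (tau R) ≤ κ) : κ.Categorical (freeTheory R) := fun M N hM hN =>
  nonempty_equiv_of_isFreeModule (h M M.is_model) (h N N.is_model) (hM ▸ hκ) (hM.trans hN.symm)

end Free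

end FreeModuleTheory

/-- The third conjunct is the form of categoricity (in every cardinal from `τ⁺` on) that is
mentioned as equivalent to `τ⁺`-categoricity. -/
theorem lemma2p10 (R : Type u) [Ring R] :
    (FreeModuleTheory.FreeElementary R → FreeModuleTheory.AllModelsFree R) ∧
    (FreeModuleTheory.AllModelsFree R →
      (Order.succ (FreeModuleTheory.tau R)).Categorical (FreeModuleTheory.freeTheory R)) ∧
    (FreeModuleTheory.AllModelsFree R →
      ∀ κ : Cardinal.{u}, Order.succ (FreeModuleTheory.tau R) ≤ κ →
        κ.Categorical (FreeModuleTheory.freeTheory R)) ∧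
    ((Order.succ (FreeModuleTheory.tau R)).Categorical (FreeModuleTheory.freeTheory R) →
      FreeModuleTheory.PowersFree R) :=
  ⟨fun h => h.allModelsFree, fun h => h.categorical le_rfl, fun h _ hκ => h.categorical hκ,
    FreeModuleTheory.powersFree_of_categorical⟩
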